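/- A Buffon machine is a deterministic computable device (equivalently, a Turing machine or a register machine) that can, at any time, call for the next of a sequence of independent fair coin flips or for the next of a sequence of independent Bernoulli input bits, the latter of unknown parameter $x$ and independent of the flips, and that can halt and output a bit. A function $\phi:(0,1)\to(0,1)$ admits a strong simulation if there is a single Buffon machine, not depending on $x$, such that, for every $x\in(0,1)$, when the input bits have parameter $x$ the machine halts with probability $1$, outputs $1$ with probability exactly $\phi(x)$, and uses a total number $C$ of random bits (fair flips and input bits together) that has exponential tails: there are constants $K$ and $\rho\in[0,1)$, which may depend on $x$, such that $\mathbb{P}(C>m)\le K\rho^{m}$ for all integers $m\ge 0$. Theorem. Each of the following functions of $x\in(0,1)$ takes its values in $(0,1)$ and admits a strong simulation: \[ \begin{array}{l} e^{-x},\quad e^{x-1},\quad (1-x)e^{x},\quad x e^{1-x},\\[1mm] \dfrac{x}{\log\frac{1}{1-x}},\quad \dfrac{1-x}{\log\frac1x},\quad (1-x)\log\dfrac{1}{1-x},\quad x\log\dfrac1x,\\[3mm] \cos x,\quad \dfrac{1-x}{\cos x},\quad \dfrac{x}{\tan x},\quad (1-x)\tan x. \end{array} \] -/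

import Mathlib

open MeasureTheory ProbabilityTheory

/-- The instructions of a Buffon machine: halt and output a bit, make a step of pure computation,
flip the machine's own fair coin, or draw the next bit from the input. -/
inductive BuffonInstr
  | halt (b : Bool)
  | compute
  | flip
  | input

/-- Numbering of the five instructions. -/
def BuffonInstr.equivFin : BuffonInstr ≃ Fin 5 where
  toFun
    | .halt false => 0
    | .halt true => 1
    | .compute => 2
    | .flip => 3
    | .input => 4
  invFun
    | 0 => .halt false
    | 1 => .halt true
    | 2 => .compute
    | 3 => .flip
    | 4 => .input
  left_inv := by rintro ((_ | _) | _ | _ | _) <;> rfl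
  right_inv := by intro i; fin_cases i <;> rfl

instance : Primcodable BuffonInstr := Primcodable.ofEquiv (Fin 5) BuffonInstr.equivFin

/-- A Buffon machine with one input and one output bit: a deterministic device whose states are
finite (integer-codable) data and which passes from state to state by a computable rule, with
access to a source of fair coin flips and to a source of input bits.
`instr s` is the instruction carried out in state `s`, and `next s b` is the following state when
the instruction has obtained the bit `b` (for a step of pure computation, which obtains no bit,
`b` is `false`). The rule is computable in the sense of Turing machines or register machines, and
any such machine is of this form, its configurations being the states. -/
structure BuffonMachine where
  State : Type
  [primcodable : Primcodable State]
  start : State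
  instr : State → BuffonInstr
  next : State → Bool → State
  computable_instr : Computable instr
  computable_next : Computable₂ next

namespace BuffonMachine

/-- A configuration of a computation: the state, and how many fair flips and how many input bits
have been used. -/
@[ext]
structure Config (M : BuffonMachine) where
  state : M.State
  flips : ℕ
  inputs : ℕ

variable (M : BuffonMachine)

/-- One step of the computation. The first component of `ω` is the sequence of fair flips, the
second one the sequence of input bits; each bit is used at most once, in order. -/
def step (ω : (ℕ → Bool) × (ℕ → Bool)) (c : M.Config) : M.Config :=
  match M.instr c.state with
  | .halt _ => c
  | .compute => ⟨M.next c.state false, c.flips, c.inputs⟩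
  | .flip => ⟨M.next c.state (ω.1 c.flips), c.flips + 1, c.inputs⟩
  | .input => ⟨M.next c.state (ω.2 c.inputs), c.flips, c.inputs + 1⟩

/-- The configuration after `n` steps (a machine that has halted stays as it is). -/
def run (ω : (ℕ → Bool) × (ℕ → Bool)) (n : ℕ) : M.Config :=
  (M.step ω)^[n] ⟨M.start, 0, 0⟩

/-- The machine halts, with the output bit `b`. -/
def Outputs (ω : (ℕ → Bool) × (ℕ → Bool)) (b : Bool) : Prop :=
  ∃ n, M.instr (M.run ω n).state = .halt b

/-- The cost of the computation: the total number of random bits (fair flips and input bits) that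
are used. -/
noncomputable def cost (ω : (ℕ → Bool) × (ℕ → Bool)) : ℕ∞ :=
  ⨆ n, (((M.run ω n).flips + (M.run ω n).inputs : ℕ) : ℕ∞)

end BuffonMachine

/-- A sequence of independent bits, each equal to `true` with probability `p`. -/
noncomputable def bernoulliStream (p : unitInterval) : Measure (ℕ → Bool) :=
  Measure.infinitePi fun _ => bernoulliMeasure true false p

/-- The randomness available to a machine: an infinite sequence of fair flips and, independent of
it, an infinite sequence of independent input bits of parameter `p`. -/
noncomputable def buffonSource (p : unitInterval) : Measure ((ℕ → Bool) × (ℕ → Bool)) :=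
  (bernoulliStream ⟨1 / 2, by norm_num, by norm_num⟩).prod (bernoulliStream p)

/-- The machine `M` realizes `φ` strongly: for every input parameter `p` in `(0, 1)`, it halts
with probability `1`, its output is Bernoulli of parameter `φ p`, and its cost has exponential
tails. The machine does not depend on `p`; the constants of the tail bound may. -/
def BuffonMachine.StronglyRealizes (M : BuffonMachine) (φ : ℝ → ℝ) : Prop :=
  ∀ p : unitInterval, 0 < p → p < 1 →
    (∀ᵐ ω ∂buffonSource p, ∃ b, M.Outputs ω b) ∧
    (buffonSource p).real {ω | M.Outputs ω true} = φ p ∧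
    ∃ K ρ : ℝ, 0 ≤ ρ ∧ ρ < 1 ∧
      ∀ m : ℕ, (buffonSource p).real {ω | (m : ℕ∞) < M.cost ω} ≤ K * ρ ^ m

/-- A function on `(0, 1)` with values in `(0, 1)` is strongly realizable (has a strong
simulation) if some Buffon machine realizes it strongly. Values of `φ` outside `(0, 1)` play no
role. -/
def StronglyRealizable (φ : ℝ → ℝ) : Prop :=
  (∀ x ∈ Set.Ioo (0 : ℝ) 1, φ x ∈ Set.Ioo (0 : ℝ) 1) ∧
    ∃ M : BuffonMachine, M.StronglyRealizes φ

/-!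
A von Neumann schema with a power series `A x = ∑ aₙ xⁿ`, `0 ≤ aₙ ≤ 1`: a trial reads input bits up
to the first `false`, so that their number is `n` with probability `(1 - x) xⁿ`, and then succeeds
with probability `aₙ`, for which fair flips are compared with the binary digits of the rational
number `aₙ`. The output of a single trial is `true` with probability `(1 - x) A x`. If instead
trials are repeated until one succeeds, and the output tells whether its number was `k`, then the
output is `true` with probability `aₖ xᵏ / A x`. The four series of `exp x`, `log (1 / (1 - x))`,
`1 / cos x` and `tan x` give the functions of the theorem, up to the substitution of `1 - x` for
`x`, that is, the negation of the input bits.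

For an arbitrary machine, one step acts on functions of the state by the averaging operator `T`. If
within `L` steps a halted state is within reach from every state, then `T ^ L` contracts the
probability of still running by a factor less than `1`. This is the exponential tail, and it also
identifies the output probability with any `T`-invariant function with values in `[0, 1]` that has
the right values at the halted states.
-/

/-- The sequence that starts with `x` and continues with `η`. -/
def consSeq {X : Type*} (x : X) (η : ℕ → X) : ℕ → X
  | 0 => x
  | n + 1 => η n

lemma measurable_consSeq {X : Type*} [MeasurableSpace X] :
    Measurable (Function.uncurry (consSeq (X := X))) := by
  refine measurable_pi_lambda _ fun n => ?_
  cases n with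
  | zero => exact measurable_fst
  | succ n => exact (measurable_pi_apply n).comp measurable_snd

lemma consSeq_preimage_pi_range {X : Type*} (n : ℕ) (t : ℕ → Set X) :
    Function.uncurry consSeq ⁻¹' Set.pi (Finset.range (n + 1)) t =
      t 0 ×ˢ Set.pi (Finset.range n) (fun i => t (i + 1)) := by
  ext ⟨x, η⟩
  simp only [Set.mem_preimage, Set.mem_pi, Finset.mem_coe, Finset.mem_range, Set.mem_prod]
  refine ⟨fun h => ⟨h 0 n.succ_pos, fun i hi => h (i + 1) (by omega)⟩, ?_⟩
  rintro ⟨hx, hη⟩ (_ | i) hi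
  · exact hx
  · exact hη i (by omega)

theorem measurePreserving_consSeq {X : Type*} [MeasurableSpace X] (μ : Measure X)
    [IsProbabilityMeasure μ] :
    MeasurePreserving (Function.uncurry consSeq)
      (μ.prod (Measure.infinitePi fun _ : ℕ => μ)) (Measure.infinitePi fun _ => μ) := by
  classical
  refine ⟨measurable_consSeq, Measure.eq_infinitePi _ fun s t ht => ?_⟩
  obtain ⟨n, hn⟩ : ∃ n, s ⊆ Finset.range (n + 1) :=
    ⟨s.sup id, fun i hi => Finset.mem_range_succ_iff.2 (Finset.le_sup (f := id) hi)⟩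
  set u : ℕ → Set X := fun i => if i ∈ s then t i else Set.univ with hu
  have hmeas : ∀ i, MeasurableSet (u i) := fun i => by
    by_cases hi : i ∈ s <;> simp [u, hi, ht i]
  have hbox : Set.pi s t = Set.pi (Finset.range (n + 1)) u := by
    ext η
    simp only [Set.mem_pi, Finset.mem_coe, hu]
    refine ⟨fun h i _ => ?_, fun h i hi => by simpa [hi] using h i (hn hi)⟩
    by_cases hi : i ∈ s <;> simp [hi, h]
  have hprod : ∏ i ∈ s, μ (t i) = ∏ i ∈ Finset.range (n + 1), μ (u i) := by
    rw [← Finset.prod_subset hn fun i _ hi => by simp [u, hi]]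
    exact Finset.prod_congr rfl fun i hi => by simp [u, hi]
  rw [hbox, hprod, Finset.prod_range_succ', Measure.map_apply measurable_consSeq
    (.pi (Finset.countable_toSet _) fun i _ => hmeas i), consSeq_preimage_pi_range,
    Measure.prod_prod, Measure.infinitePi_pi _ fun i _ => hmeas _, mul_comm]

/-- The mean of `g` under a random bit that is `true` with probability `p`. -/
noncomputable def bitMean (p : unitInterval) (g : Bool → ℝ) : ℝ :=
  p * g true + (1 - p) * g false

lemma bitMean_mono (p : unitInterval) {g h : Bool → ℝ} (hgh : ∀ b, g b ≤ h b) :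
    bitMean p g ≤ bitMean p h :=
  add_le_add (mul_le_mul_of_nonneg_left (hgh _) p.2.1)
    (mul_le_mul_of_nonneg_left (hgh _) (sub_nonneg.2 p.2.2))

lemma bitMean_le_one_sub_mul {p : unitInterval} {q c : ℝ} (hq : q ≤ p) (hq' : q ≤ 1 - p)
    (hc : 0 ≤ c) {g : Bool → ℝ} (hg : ∀ b, g b ≤ 1) {b : Bool} (hb : g b ≤ 1 - c) :
    bitMean p g ≤ 1 - q * c := by
  have hp0 := p.2.1
  have hp1 := sub_nonneg.2 p.2.2
  unfold bitMean
  cases b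
  · nlinarith [mul_le_mul_of_nonneg_left (hg true) hp0, mul_le_mul_of_nonneg_left hb hp1,
      mul_le_mul_of_nonneg_right hq' hc]
  · nlinarith [mul_le_mul_of_nonneg_left (hg false) hp1, mul_le_mul_of_nonneg_left hb hp0,
      mul_le_mul_of_nonneg_right hq hc]

lemma measureReal_eq_bitMean {X : Type*} [MeasurableSpace X] {μ : Measure X} [IsFiniteMeasure μ]
    {p : unitInterval} {T : Bool → X → X}
    (hT : MeasurePreserving (Function.uncurry T) ((bernoulliMeasure true false p).prod μ) μ)
    {E : Set X} (hE : MeasurableSet E) :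
    μ.real E = bitMean p fun b => μ.real (T b ⁻¹' E) := by
  have hpre : MeasurableSet (Function.uncurry T ⁻¹' E) := hT.measurable hE
  rw [measureReal_def, ← hT.measure_preimage hE.nullMeasurableSet, ← measureReal_def,
    bernoulliMeasure_def, Measure.add_prod, Measure.prod_smul_left, Measure.prod_smul_left,
    Measure.dirac_prod, Measure.dirac_prod, measureReal_add_apply, measureReal_nnreal_smul_apply,
    measureReal_nnreal_smul_apply, map_measureReal_apply measurable_prodMk_left hpre,
    map_measureReal_apply measurable_prodMk_left hpre]
  rfl

/-- The parameter of a fair coin. -/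
noncomputable def fairParameter : unitInterval := ⟨1 / 2, by norm_num, by norm_num⟩

instance (p : unitInterval) : IsProbabilityMeasure (bernoulliStream p) :=
  inferInstanceAs (IsProbabilityMeasure (Measure.infinitePi _))

instance (p : unitInterval) : IsProbabilityMeasure (buffonSource p) :=
  inferInstanceAs (IsProbabilityMeasure ((bernoulliStream _).prod (bernoulliStream p)))

lemma measurePreserving_consSeq_fst (p : unitInterval) :
    MeasurePreserving (Function.uncurry fun b => Prod.map (consSeq b) id)
      ((bernoulliMeasure true false fairParameter).prod (buffonSource p)) (buffonSource p) :=
  ((measurePreserving_consSeq (bernoulliMeasure true false fairParameter)).prod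
    (.id (bernoulliStream p))).comp (measurePreserving_prodAssoc _ _ _).symm

lemma measurePreserving_consSeq_snd (p : unitInterval) :
    MeasurePreserving (Function.uncurry fun b => Prod.map id (consSeq b))
      ((bernoulliMeasure true false p).prod (buffonSource p)) (buffonSource p) :=
  ((MeasurePreserving.id _).prod (measurePreserving_consSeq (bernoulliMeasure true false p))).comp
    ((measurePreserving_prodAssoc _ _ _).comp
      ((Measure.measurePreserving_swap.prod (.id _)).comp (measurePreserving_prodAssoc _ _ _).symm))

lemma measurable_apply_of_countable {ι Ω X : Type*} [Countable ι] [MeasurableSpace ι]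
    [MeasurableSingletonClass ι] [MeasurableSpace Ω] [MeasurableSpace X] {f : Ω → ι}
    (hf : Measurable f) {F : ι → Ω → X} (hF : ∀ i, Measurable (F i)) :
    Measurable fun ω => F (f ω) ω :=
  (measurable_from_prod_countable_right (f := Function.uncurry F) hF).comp
    (hf.prodMk measurable_id)

namespace BuffonMachine

variable (M : BuffonMachine)

/-- The state reached after `n` steps from the state `s`. -/
def stateAfter (ω : (ℕ → Bool) × (ℕ → Bool)) (n : ℕ) (s : M.State) : M.State :=
  ((M.step ω)^[n] ⟨s, 0, 0⟩).state

/-- The transition operator of the Markov chain of states, for inputs of parameter `p`. -/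
noncomputable def transition (p : unitInterval) : Module.End ℝ (M.State → ℝ) where
  toFun g s :=
    match M.instr s with
    | .halt _ => g s
    | .compute => g (M.next s false)
    | .flip => bitMean fairParameter fun b => g (M.next s b)
    | .input => bitMean p fun b => g (M.next s b)
  map_add' g h := by
    ext s
    cases hs : M.instr s <;> simp only [hs, bitMean, Pi.add_apply] <;> ring
  map_smul' c g := by
    ext s
    cases hs : M.instr s <;>
      simp only [hs, bitMean, Pi.smul_apply, smul_eq_mul, RingHom.id_apply] <;> ring

lemma transition_apply (p : unitInterval) (g : M.State → ℝ) (s : M.State) :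
    M.transition p g s =
      match M.instr s with
      | .halt _ => g s
      | .compute => g (M.next s false)
      | .flip => bitMean fairParameter fun b => g (M.next s b)
      | .input => bitMean p fun b => g (M.next s b) :=
  rfl

/-- The states in which the machine has halted. -/
def haltedStates : Set M.State := {s | ∃ b, M.instr s = .halt b}

/-- Some outcome of the random bits leads from the state to a halted state within `n` steps. -/
inductive HaltsWithin : ℕ → M.State → Prop
  | halt {n : ℕ} {s : M.State} {b : Bool} (hs : M.instr s = .halt b) : HaltsWithin n s
  | compute {n : ℕ} {s : M.State} (hs : M.instr s = .compute)
      (h : HaltsWithin n (M.next s false)) : HaltsWithin (n + 1) s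
  | flip {n : ℕ} {s : M.State} (hs : M.instr s = .flip) (b : Bool)
      (h : HaltsWithin n (M.next s b)) : HaltsWithin (n + 1) s
  | input {n : ℕ} {s : M.State} (hs : M.instr s = .input) (b : Bool)
      (h : HaltsWithin n (M.next s b)) : HaltsWithin (n + 1) s

variable {M}

lemma HaltsWithin.mono {m n : ℕ} {s : M.State} (h : M.HaltsWithin m s) (hmn : m ≤ n) :
    M.HaltsWithin n s := by
  induction h generalizing n with
  | halt hs => exact .halt hs
  | compute hs _ ih =>
    obtain ⟨n, rfl⟩ := Nat.exists_eq_add_one_of_ne_zero (by omega : n ≠ 0)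
    exact .compute hs (ih (by omega))
  | flip hs b _ ih =>
    obtain ⟨n, rfl⟩ := Nat.exists_eq_add_one_of_ne_zero (by omega : n ≠ 0)
    exact .flip hs b (ih (by omega))
  | input hs b _ ih =>
    obtain ⟨n, rfl⟩ := Nat.exists_eq_add_one_of_ne_zero (by omega : n ≠ 0)
    exact .input hs b (ih (by omega))

variable (M)

section Distribution

lemma measurable_iterate_step (n : ℕ) (c : M.Config) :
    Measurable[_, ⊤] fun ω => (M.step ω)^[n] c := by
  let : MeasurableSpace M.Config := ⊤
  induction n generalizing c with
  | zero => exact measurable_const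
  | succ n ih =>
    simp only [Function.iterate_succ_apply, step]
    cases M.instr c.state with
    | halt b => exact ih c
    | compute => exact ih _
    | flip =>
      exact measurable_apply_of_countable (f := fun ω => ω.1 c.flips) (by fun_prop)
        fun b => ih ⟨M.next c.state b, c.flips + 1, c.inputs⟩
    | input =>
      exact measurable_apply_of_countable (f := fun ω => ω.2 c.inputs) (by fun_prop)
        fun b => ih ⟨M.next c.state b, c.flips, c.inputs + 1⟩

lemma measurableSet_stateAfter (n : ℕ) (s : M.State) (A : Set M.State) :
    MeasurableSet {ω | M.stateAfter ω n s ∈ A} :=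
  M.measurable_iterate_step n ⟨s, 0, 0⟩ (t := Config.state ⁻¹' A) trivial

lemma stateAfter_succ_of_halt {s : M.State} {b : Bool} (hs : M.instr s = .halt b)
    (ω : (ℕ → Bool) × (ℕ → Bool)) (n : ℕ) : M.stateAfter ω (n + 1) s = M.stateAfter ω n s := by
  simp [stateAfter, step, hs]

lemma stateAfter_succ_of_compute {s : M.State} (hs : M.instr s = .compute)
    (ω : (ℕ → Bool) × (ℕ → Bool)) (n : ℕ) :
    M.stateAfter ω (n + 1) s = M.stateAfter ω n (M.next s false) := by
  simp [stateAfter, step, hs]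

lemma stateAfter_succ_of_flip {s : M.State} (hs : M.instr s = .flip) (b : Bool)
    (ω : (ℕ → Bool) × (ℕ → Bool)) (n : ℕ) :
    M.stateAfter (Prod.map (consSeq b) id ω) (n + 1) s = M.stateAfter ω n (M.next s b) := by
  have hshift : Function.Semiconj
      (fun c : M.Config => (⟨c.state, c.flips + 1, c.inputs⟩ : M.Config))
      (M.step ω) (M.step (Prod.map (consSeq b) id ω)) := by
    intro c
    cases hc : M.instr c.state <;> simp [step, hc, consSeq]
  simpa [stateAfter, step, hs, consSeq] using
    congrArg Config.state ((hshift.iterate_right n).eq ⟨M.next s b, 0, 0⟩).symm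

lemma stateAfter_succ_of_input {s : M.State} (hs : M.instr s = .input) (b : Bool)
    (ω : (ℕ → Bool) × (ℕ → Bool)) (n : ℕ) :
    M.stateAfter (Prod.map id (consSeq b) ω) (n + 1) s = M.stateAfter ω n (M.next s b) := by
  have hshift : Function.Semiconj
      (fun c : M.Config => (⟨c.state, c.flips, c.inputs + 1⟩ : M.Config))
      (M.step ω) (M.step (Prod.map id (consSeq b) ω)) := by
    intro c
    cases hc : M.instr c.state <;> simp [step, hc, consSeq]
  simpa [stateAfter, step, hs, consSeq] using
    congrArg Config.state ((hshift.iterate_right n).eq ⟨M.next s b, 0, 0⟩).symm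

theorem measureReal_stateAfter_mem (p : unitInterval) (n : ℕ) (s : M.State) (A : Set M.State) :
    (buffonSource p).real {ω | M.stateAfter ω n s ∈ A} =
      (M.transition p ^ n) (A.indicator 1) s := by
  induction n generalizing s with
  | zero => by_cases hs : s ∈ A <;> simp [stateAfter, hs]
  | succ n ih =>
    have hmeas := M.measurableSet_stateAfter (n + 1) s A
    rw [pow_succ', Module.End.mul_apply, transition_apply]
    cases hs : M.instr s with
    | halt b => simp only [M.stateAfter_succ_of_halt hs, ih]
    | compute => simp only [M.stateAfter_succ_of_compute hs, ih]
    | flip =>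
      simp only [measureReal_eq_bitMean (measurePreserving_consSeq_fst p) hmeas,
        Set.preimage_ofPred_eq, M.stateAfter_succ_of_flip hs, ih]
    | input =>
      simp only [measureReal_eq_bitMean (measurePreserving_consSeq_snd p) hmeas,
        Set.preimage_ofPred_eq, M.stateAfter_succ_of_input hs, ih]

end Distribution

section Operator

variable (p : unitInterval)

lemma transition_apply_of_halted {s : M.State} (hs : s ∈ M.haltedStates) (g : M.State → ℝ) :
    M.transition p g s = g s := by
  obtain ⟨b, hb⟩ := hs
  simp only [transition_apply, hb]

lemma transition_pow_apply_of_halted {s : M.State} (hs : s ∈ M.haltedStates) (g : M.State → ℝ)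
    (n : ℕ) : (M.transition p ^ n) g s = g s := by
  induction n with
  | zero => rfl
  | succ n ih =>
    rw [pow_succ', Module.End.mul_apply, M.transition_apply_of_halted p hs, ih]

lemma transition_mono : Monotone (M.transition p) := by
  intro g h hgh s
  simp only [transition_apply]
  cases M.instr s with
  | halt b => exact hgh s
  | compute => exact hgh _
  | flip => exact bitMean_mono _ fun b => hgh _
  | input => exact bitMean_mono _ fun b => hgh _

lemma transition_pow_mono (n : ℕ) : Monotone (M.transition p ^ n) := by
  rw [Module.End.coe_pow]
  exact (M.transition_mono p).iterate n

lemma transition_one : M.transition p 1 = 1 := by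
  ext s
  simp only [transition_apply]
  cases M.instr s <;> simp [bitMean]

lemma transition_pow_le_one {g : M.State → ℝ} (hg : g ≤ 1) (n : ℕ) :
    (M.transition p ^ n) g ≤ 1 := by
  have hone : (M.transition p ^ n) 1 = 1 := by
    rw [Module.End.coe_pow]
    exact Function.iterate_fixed (M.transition_one p) n
  exact (M.transition_pow_mono p n hg).trans_eq hone

/-- The indicator function of the states in which the machine has not halted. -/
noncomputable def running : M.State → ℝ := M.haltedStatesᶜ.indicator 1

lemma running_le_one : M.running ≤ 1 := Set.indicator_le_self' fun _ _ => zero_le_one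

lemma le_smul_running {g : M.State → ℝ} {r : ℝ} (hg : ∀ s, g s ≤ r)
    (hhalt : ∀ s ∈ M.haltedStates, g s = 0) : g ≤ r • M.running := by
  intro s
  by_cases hs : s ∈ M.haltedStates
  · simp [running, hs, hhalt s hs]
  · simpa [running, hs] using hg s

lemma transition_pow_running_of_halted {s : M.State} (hs : s ∈ M.haltedStates) (n : ℕ) :
    (M.transition p ^ n) M.running s = 0 := by
  rw [M.transition_pow_apply_of_halted p hs]
  simp [running, hs]

lemma transition_pow_running_antitone : Antitone fun n => (M.transition p ^ n) M.running := by
  refine antitone_nat_of_succ_le fun n => ?_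
  have hstep : M.transition p M.running ≤ M.running := by
    simpa using M.le_smul_running (r := 1)
      (M.transition_pow_le_one p M.running_le_one 1)
      fun s hs => M.transition_pow_running_of_halted p hs 1
  rw [pow_succ, Module.End.mul_apply]
  exact M.transition_pow_mono p n hstep

variable {M p}

lemma HaltsWithin.transition_pow_running_le {q : ℝ} (hq0 : 0 ≤ q) (hq : q ≤ 1 / 2) (hqp : q ≤ p)
    (hqp' : q ≤ 1 - p) {n : ℕ} {s : M.State} (h : M.HaltsWithin n s) :
    (M.transition p ^ n) M.running s ≤ 1 - q ^ n := by
  have hq1 : q ≤ 1 := by linarith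
  have hle := fun n => M.transition_pow_le_one p M.running_le_one n
  induction h with
  | halt hs =>
    rw [M.transition_pow_running_of_halted p ⟨_, hs⟩]
    exact sub_nonneg.2 (pow_le_one₀ hq0 hq1)
  | @compute n s hs _ ih =>
    rw [pow_succ', Module.End.mul_apply, transition_apply, hs]
    exact ih.trans (sub_le_sub_left (pow_le_pow_of_le_one hq0 hq1 n.le_succ) 1)
  | @flip n s hs b _ ih =>
    rw [pow_succ', Module.End.mul_apply, transition_apply, hs, pow_succ']
    exact bitMean_le_one_sub_mul hq (hq.trans_eq (by norm_num [fairParameter])) (pow_nonneg hq0 n)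
      (fun b => hle n (M.next s b)) ih
  | @input n s hs b _ ih =>
    rw [pow_succ', Module.End.mul_apply, transition_apply, hs, pow_succ']
    exact bitMean_le_one_sub_mul hqp hqp' (pow_nonneg hq0 n) (fun b => hle n (M.next s b)) ih

end Operator

end BuffonMachine

lemma end_pow_apply_le_of_monotone {E : Type*} [AddCommGroup E] [PartialOrder E] [Module ℝ E]
    [PosSMulMono ℝ E] {T : Module.End ℝ E} (hT : Monotone T) {g : E} {r : ℝ}
    (hr : 0 ≤ r) (hg : T g ≤ r • g) (k : ℕ) : (T ^ k) g ≤ r ^ k • g := by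
  induction k with
  | zero => simp
  | succ k ih =>
    calc (T ^ (k + 1)) g = T ((T ^ k) g) := by rw [pow_succ', Module.End.mul_apply]
      _ ≤ T (r ^ k • g) := hT ih
      _ = r ^ k • T g := map_smul T _ g
      _ ≤ r ^ k • r • g := smul_le_smul_of_nonneg_left hg (pow_nonneg hr k)
      _ = r ^ (k + 1) • g := by rw [smul_smul, pow_succ]

lemma exists_le_mul_pow_of_antitone {f : ℕ → ℝ} (hf : Antitone f) {r : ℝ} (hr0 : 0 < r)
    (hr1 : r < 1) {L : ℕ} (h : ∀ k, f ((L + 1) * k) ≤ r ^ k) :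
    ∃ K ρ : ℝ, 0 ≤ ρ ∧ ρ < 1 ∧ ∀ n, f n ≤ K * ρ ^ n := by
  obtain ⟨ρ, hρ0, hρ⟩ : ∃ ρ : ℝ, 0 < ρ ∧ ρ ^ (L + 1) = r :=
    ⟨r ^ (((L + 1 : ℕ) : ℝ)⁻¹), Real.rpow_pos_of_pos hr0 _,
      Real.rpow_inv_natCast_pow hr0.le L.succ_ne_zero⟩
  have hρ1 : ρ < 1 := (pow_lt_one_iff_of_nonneg hρ0.le L.succ_ne_zero).1 (hρ.trans_lt hr1)
  refine ⟨r⁻¹, ρ, hρ0.le, hρ1, fun n => ?_⟩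
  have hn : n ≤ (L + 1) * (n / (L + 1)) + (L + 1) :=
    (Nat.div_add_mod n (L + 1)).symm.trans_le
      (Nat.add_le_add_left (Nat.mod_lt n L.succ_pos).le _)
  calc f n ≤ f ((L + 1) * (n / (L + 1))) := hf (Nat.mul_div_le n (L + 1))
    _ ≤ r ^ (n / (L + 1)) := h _
    _ = r⁻¹ * ρ ^ ((L + 1) * (n / (L + 1)) + (L + 1)) := by
      rw [pow_add, pow_mul, hρ]; field_simp
    _ ≤ r⁻¹ * ρ ^ n := by
      gcongr r⁻¹ * ?_
      exact pow_le_pow_of_le_one hρ0.le hρ1.le hn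

namespace BuffonMachine

variable (M : BuffonMachine)

theorem exists_transition_pow_running_le {p : unitInterval} (hp0 : 0 < p) (hp1 : p < 1) {L : ℕ}
    (hL : ∀ s, M.HaltsWithin L s) (s : M.State) :
    ∃ K ρ : ℝ, 0 ≤ ρ ∧ ρ < 1 ∧ ∀ n, (M.transition p ^ n) M.running s ≤ K * ρ ^ n := by
  have hp0' : (0 : ℝ) < p := hp0
  have hp1' : (p : ℝ) < 1 := hp1
  obtain ⟨q, hq0, hq, hqp, hqp'⟩ : ∃ q : ℝ, 0 < q ∧ q ≤ 1 / 2 ∧ q ≤ p ∧ q ≤ 1 - p :=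
    ⟨min (1 / 2) (min p (1 - p)), by simp [hp0', hp1'], by simp, by simp, by simp⟩
  set r := 1 - q ^ (L + 1)
  have hr1 : r < 1 := sub_lt_self 1 (pow_pos hq0 _)
  have hr0 : 0 < r := sub_pos.2 (pow_lt_one₀ hq0.le (by linarith) L.succ_ne_zero)
  have hblock : (M.transition p ^ (L + 1)) M.running ≤ r • M.running :=
    M.le_smul_running
      (fun s => ((hL s).mono L.le_succ).transition_pow_running_le hq0.le hq hqp hqp')
      fun s hs => M.transition_pow_running_of_halted p hs _
  refine exists_le_mul_pow_of_antitone (L := L)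
    (fun m n hmn => M.transition_pow_running_antitone p hmn s) hr0 hr1 fun k => ?_
  calc (M.transition p ^ ((L + 1) * k)) M.running s
      ≤ r ^ k * M.running s := by
        rw [pow_mul]
        exact end_pow_apply_le_of_monotone (M.transition_pow_mono p _) hr0.le hblock k s
    _ ≤ r ^ k := mul_le_of_le_one_right (pow_nonneg hr0.le k) (M.running_le_one s)

lemma run_succ (ω : (ℕ → Bool) × (ℕ → Bool)) (n : ℕ) : M.run ω (n + 1) = M.step ω (M.run ω n) :=
  Function.iterate_succ_apply' _ _ _

lemma run_eq_of_halted {ω : (ℕ → Bool) × (ℕ → Bool)} {m : ℕ}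
    (h : (M.run ω m).state ∈ M.haltedStates) {n : ℕ} (hmn : m ≤ n) : M.run ω n = M.run ω m := by
  obtain ⟨b, hb⟩ := h
  induction n, hmn using Nat.le_induction with
  | base => rfl
  | succ n _ ih => simp [run_succ, ih, step, hb]

lemma flips_add_inputs_run_le (ω : (ℕ → Bool) × (ℕ → Bool)) (n : ℕ) :
    (M.run ω n).flips + (M.run ω n).inputs ≤ n := by
  induction n with
  | zero => simp [run]
  | succ n ih =>
    rw [run_succ, step]
    cases M.instr (M.run ω n).state <;> dsimp only <;> omega

lemma cost_le_of_halted {ω : (ℕ → Bool) × (ℕ → Bool)} {m : ℕ}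
    (h : (M.run ω m).state ∈ M.haltedStates) : M.cost ω ≤ m := by
  refine iSup_le fun n => ?_
  rcases le_total m n with hmn | hnm
  · rw [M.run_eq_of_halted h hmn]
    exact_mod_cast M.flips_add_inputs_run_le ω m
  · exact_mod_cast (M.flips_add_inputs_run_le ω n).trans hnm

lemma instr_run_of_outputs_of_halted {ω : (ℕ → Bool) × (ℕ → Bool)} {b : Bool} {m : ℕ}
    (hω : M.Outputs ω b) (h : (M.run ω m).state ∈ M.haltedStates) :
    M.instr (M.run ω m).state = .halt b := by
  obtain ⟨n, hn⟩ := hω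
  rcases le_total m n with hmn | hnm
  · rwa [← M.run_eq_of_halted h hmn]
  · rwa [M.run_eq_of_halted ⟨b, hn⟩ hnm]

/-- A bounded harmonic function of the state whose value at the halted states is their output.
Where the machine halts almost surely, it is the probability of the output `true`. -/
structure IsOutputPotential (p : unitInterval) (v : M.State → ℝ) : Prop where
  nonneg : 0 ≤ v
  le_one : v ≤ 1
  halt : ∀ s b, M.instr s = .halt b → v s = if b then 1 else 0
  harmonic : M.transition p v = v

section Criterion

variable {M} {p : unitInterval}

lemma IsOutputPotential.transition_pow_eq {v : M.State → ℝ} (hv : M.IsOutputPotential p v) (n : ℕ) :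
    (M.transition p ^ n) v = v := by
  rw [Module.End.coe_pow]
  exact Function.iterate_fixed hv.harmonic n

lemma IsOutputPotential.indicator_le {v : M.State → ℝ} (hv : M.IsOutputPotential p v) :
    {s | M.instr s = .halt true}.indicator 1 ≤ v := by
  refine Set.indicator_le' (fun s hs => ?_) fun s _ => hv.nonneg s
  simp [hv.halt s true hs]

lemma IsOutputPotential.le_indicator_add_running {v : M.State → ℝ}
    (hv : M.IsOutputPotential p v) :
    v ≤ {s | M.instr s = .halt true}.indicator 1 + M.running := by
  intro s
  by_cases hs : s ∈ M.haltedStates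
  · obtain ⟨b, hb⟩ := id hs
    cases b <;> simp [hv.halt s _ hb, hb, running, hs]
  · have hs' : M.instr s ≠ .halt true := fun h => hs ⟨true, h⟩
    simpa [running, hs, hs'] using hv.le_one s

lemma IsOutputPotential.abs_measureReal_outputs_sub_le {v : M.State → ℝ}
    (hv : M.IsOutputPotential p v) (n : ℕ) :
    |(buffonSource p).real {ω | M.Outputs ω true} - v M.start| ≤
      (M.transition p ^ n) M.running M.start := by
  set A : Set M.State := {s | M.instr s = .halt true}
  have hA := M.measureReal_stateAfter_mem p n M.start A
  have hN := M.measureReal_stateAfter_mem p n M.start M.haltedStatesᶜ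
  have hlower : (buffonSource p).real {ω | M.stateAfter ω n M.start ∈ A} ≤
      (buffonSource p).real {ω | M.Outputs ω true} :=
    measureReal_mono fun ω hω => ⟨n, hω⟩
  have hsub : {ω | M.Outputs ω true} ⊆ {ω | M.stateAfter ω n M.start ∈ A} ∪
      {ω | M.stateAfter ω n M.start ∈ M.haltedStatesᶜ} := fun ω hω =>
    (Classical.em _).imp_left (M.instr_run_of_outputs_of_halted hω)
  have hupper := (measureReal_mono (μ := buffonSource p) hsub).trans (measureReal_union_le _ _)
  have hv_lower := M.transition_pow_mono p n hv.indicator_le M.start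
  have hv_upper := M.transition_pow_mono p n hv.le_indicator_add_running M.start
  rw [map_add, Pi.add_apply] at hv_upper
  rw [hv.transition_pow_eq] at hv_lower hv_upper
  rw [abs_le]
  constructor <;> simp only [running] at * <;> linarith

theorem stronglyRealizes_of_outputPotential {φ : ℝ → ℝ} {L : ℕ} (hL : ∀ s, M.HaltsWithin L s)
    (hφ : ∀ p, 0 < p → p < 1 → ∃ v, M.IsOutputPotential p v ∧ v M.start = φ p) :
    M.StronglyRealizes φ := by
  intro p hp0 hp1
  obtain ⟨v, hv, hstart⟩ := hφ p hp0 hp1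
  obtain ⟨K, ρ, hρ0, hρ1, hK⟩ := M.exists_transition_pow_running_le hp0 hp1 hL M.start
  have hlim : Filter.Tendsto (fun n => K * ρ ^ n) Filter.atTop (nhds 0) := by
    simpa using (tendsto_pow_atTop_nhds_zero_of_lt_one hρ0 hρ1).const_mul K
  have hrunning : ∀ n, (buffonSource p).real {ω | (M.run ω n).state ∉ M.haltedStates} ≤ K * ρ ^ n :=
    fun n => (M.measureReal_stateAfter_mem p n M.start M.haltedStatesᶜ).trans_le (hK n)
  refine ⟨?_, ?_, K, ρ, hρ0, hρ1, fun m => ?_⟩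
  · have hnull : (buffonSource p).real {ω | ¬∃ b, M.Outputs ω b} = 0 := by
      refine le_antisymm (ge_of_tendsto' hlim fun n => (measureReal_mono ?_).trans (hrunning n))
        measureReal_nonneg
      exact fun ω hω ⟨b, hb⟩ => hω ⟨b, n, hb⟩
    rwa [measureReal_eq_zero_iff, ← ae_iff] at hnull
  · rw [← hstart, ← sub_eq_zero, ← abs_nonpos_iff]
    exact ge_of_tendsto' hlim fun n => (hv.abs_measureReal_outputs_sub_le n).trans (hK n)
  · exact (measureReal_mono fun ω hω h => (M.cost_le_of_halted h).not_gt hω).trans (hrunning m)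

end Criterion

end BuffonMachine

section Negation

/-- The instruction reads an input bit. -/
def BuffonInstr.readsInput : BuffonInstr → Bool
  | .input => true
  | _ => false

/-- The machine that behaves like `M` with all input bits negated. -/
def BuffonMachine.negateInput (M : BuffonMachine) : BuffonMachine where
  State := M.State
  primcodable := M.primcodable
  start := M.start
  instr := M.instr
  next s b := M.next s (xor (M.instr s).readsInput b)
  computable_instr := M.computable_instr
  computable_next := by
    let := M.primcodable
    have : Finite BuffonInstr := .of_equiv _ BuffonInstr.equivFin.symm
    have hreads : Computable fun s => (M.instr s).readsInput :=
      (Primrec.dom_finite _).to_comp.comp M.computable_instr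
    exact M.computable_next.comp .fst
      ((Primrec.dom_bool₂ xor).to_comp.comp (hreads.comp .fst) .snd)

/-- Negation of all input bits, as an equivalence of the space of random sources. -/
def negateInputs : (ℕ → Bool) × (ℕ → Bool) ≃ᵐ (ℕ → Bool) × (ℕ → Bool) :=
  .ofInvolutive (Prod.map id fun η n => !η n) (fun ω => by simp [Prod.map]) (by fun_prop)

lemma negateInputs_apply (ω : (ℕ → Bool) × (ℕ → Bool)) :
    negateInputs ω = (ω.1, fun n => !ω.2 n) :=
  rfl

lemma map_not_bernoulliMeasure (p : unitInterval) :
    (bernoulliMeasure true false p).map not =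
      bernoulliMeasure true false (unitInterval.symm p) := by
  rw [map_bernoulliMeasure, bernoulliMeasure_def, bernoulliMeasure_def, unitInterval.symm_symm,
    add_comm]
  rfl

lemma measurePreserving_negateInputs (p : unitInterval) :
    MeasurePreserving negateInputs (buffonSource p) (buffonSource (unitInterval.symm p)) := by
  have hstream : MeasurePreserving (fun (η : ℕ → Bool) n => !η n) (bernoulliStream p)
      (bernoulliStream (unitInterval.symm p)) := by
    refine ⟨by fun_prop, ?_⟩
    rw [bernoulliStream, Measure.infinitePi_map_pi _ fun _ => measurable_from_top]
    simp only [map_not_bernoulliMeasure, bernoulliStream]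
  exact (MeasurePreserving.id _).prod hstream

namespace BuffonMachine

lemma negateInput_run (M : BuffonMachine) (ω : (ℕ → Bool) × (ℕ → Bool)) (n : ℕ) :
    M.run (negateInputs ω) n =
      ⟨(M.negateInput.run ω n).state, (M.negateInput.run ω n).flips,
        (M.negateInput.run ω n).inputs⟩ := by
  have hstep : Function.Semiconj
      (fun c : M.negateInput.Config => (⟨c.state, c.flips, c.inputs⟩ : M.Config))
      (M.negateInput.step ω) (M.step (negateInputs ω)) := by
    intro c
    cases hc : M.instr c.state <;>
      simp [step, hc, negateInput, negateInputs_apply, BuffonInstr.readsInput]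
  exact ((hstep.iterate_right n).eq ⟨M.start, 0, 0⟩).symm

lemma negateInput_outputs (M : BuffonMachine) (ω : (ℕ → Bool) × (ℕ → Bool)) (b : Bool) :
    M.negateInput.Outputs ω b ↔ M.Outputs (negateInputs ω) b := by
  simp only [Outputs, negateInput_run, negateInput]

lemma negateInput_cost (M : BuffonMachine) (ω : (ℕ → Bool) × (ℕ → Bool)) :
    M.negateInput.cost ω = M.cost (negateInputs ω) := by
  simp only [cost, negateInput_run]

end BuffonMachine

theorem StronglyRealizable.comp_one_sub {φ : ℝ → ℝ} (h : StronglyRealizable φ) :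
    StronglyRealizable fun x => φ (1 - x) := by
  obtain ⟨hφ, M, hM⟩ := h
  refine ⟨fun x hx => hφ (1 - x) ⟨sub_pos.2 hx.2, sub_lt_self 1 hx.1⟩, M.negateInput,
    fun p hp0 hp1 => ?_⟩
  obtain ⟨hhalt, htrue, K, ρ, hρ0, hρ1, htail⟩ :=
    hM (unitInterval.symm p) (by rwa [unitInterval.lt_symm_comm, unitInterval.symm_zero])
      (by rwa [unitInterval.symm_lt_comm, unitInterval.symm_one])
  have hmp := measurePreserving_negateInputs p
  have hreal : ∀ E, (buffonSource p).real (negateInputs ⁻¹' E) =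
      (buffonSource (unitInterval.symm p)).real E := fun E => by
    rw [measureReal_def, hmp.measure_preimage_equiv, measureReal_def]
  simp only [M.negateInput_outputs, M.negateInput_cost]
  refine ⟨hmp.quasiMeasurePreserving.ae hhalt, (hreal _).trans htrue, K, ρ, hρ0, hρ1, fun m =>
    (hreal _).trans_le (htail m)⟩

end Negation

section GeometricAverage

lemma summable_mul_pow_of_abs_le {f : ℕ → ℝ} {C : ℝ} (hf : ∀ n, |f n| ≤ C) {x : ℝ}
    (hx : |x| < 1) : Summable fun n => f n * x ^ n := by
  refine .of_norm_bounded ((summable_geometric_of_abs_lt_one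
    ((abs_abs x).trans_lt hx)).mul_left C) fun n => ?_
  rw [Real.norm_eq_abs, abs_mul, abs_pow]
  exact mul_le_mul_of_nonneg_right (hf n) (pow_nonneg (abs_nonneg x) n)

/-- The mean of `f N` for a random number `N` of geometric distribution, `P(N = n) = (1 - x) xⁿ`:
the number of bits `true` before the first `false` among independent bits of parameter `x`. -/
noncomputable def geometricMean (x : ℝ) (f : ℕ → ℝ) : ℝ := (1 - x) * ∑' n, f n * x ^ n

lemma geometricMean_eq_of_hasSum {x a : ℝ} {f : ℕ → ℝ} (h : HasSum (fun n => f n * x ^ n) a) :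
    geometricMean x f = (1 - x) * a := by
  rw [geometricMean, h.tsum_eq]

lemma geometricMean_eq_add {x : ℝ} {f : ℕ → ℝ} (h : Summable fun n => f n * x ^ n) :
    geometricMean x f = x * geometricMean x (fun n => f (n + 1)) + (1 - x) * f 0 := by
  have hshift : ∑' n, f (n + 1) * x ^ (n + 1) = x * ∑' n, f (n + 1) * x ^ n := by
    rw [← tsum_mul_left]
    exact tsum_congr fun n => by ring
  rw [geometricMean, geometricMean, h.tsum_eq_zero_add, hshift]
  ring

lemma geometricMean_mem_Icc {x : ℝ} (hx : x ∈ Set.Ioo (0 : ℝ) 1) {f : ℕ → ℝ}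
    (hf : ∀ n, f n ∈ Set.Icc (0 : ℝ) 1) : geometricMean x f ∈ Set.Icc (0 : ℝ) 1 := by
  have hx' : 0 < 1 - x := sub_pos.2 hx.2
  have hsum : Summable fun n => f n * x ^ n :=
    summable_mul_pow_of_abs_le (fun n => abs_le.2 ⟨by linarith [(hf n).1], (hf n).2⟩)
      (abs_lt.2 ⟨by linarith [hx.1], hx.2⟩)
  refine ⟨mul_nonneg hx'.le (tsum_nonneg fun n => mul_nonneg (hf n).1 (pow_nonneg hx.1.le n)), ?_⟩
  calc geometricMean x f ≤ (1 - x) * ∑' n : ℕ, x ^ n := by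
        refine mul_le_mul_of_nonneg_left (hsum.tsum_le_tsum (fun n => ?_)
          (summable_geometric_of_lt_one hx.1.le hx.2)) hx'.le
        exact mul_le_of_le_one_left (pow_nonneg hx.1.le n) (hf n).2
    _ = 1 := by rw [tsum_geometric_of_lt_one hx.1.le hx.2, mul_inv_cancel₀ hx'.ne']

end GeometricAverage

section BinaryExpansion

/-- The first binary digit of `r / d`. -/
def binaryDigit (d r : ℕ) : Bool := decide (d ≤ 2 * r)

/-- The numerator of what remains of `r / d`, doubled, without its first binary digit. -/
def binaryRemainder (d r : ℕ) : ℕ := if d ≤ 2 * r then 2 * r - d else 2 * r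

/-- The fraction `r / d`, cut off at `1`. -/
noncomputable def cappedRatio (d r : ℕ) : ℝ := min (r / d) 1

lemma cappedRatio_mem_Icc (d r : ℕ) : cappedRatio d r ∈ Set.Icc (0 : ℝ) 1 :=
  ⟨le_min (by positivity) zero_le_one, min_le_right _ _⟩

lemma cappedRatio_eq_half_add_half {d : ℕ} (hd : 0 < d) (r : ℕ) :
    cappedRatio d r = 1 / 2 * cappedRatio d (binaryRemainder d r) +
      1 / 2 * if binaryDigit d r then 1 else 0 := by
  have hd' : (0 : ℝ) < d := Nat.cast_pos.2 hd
  by_cases h : d ≤ 2 * r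
  · have hrem : ((2 * r - d : ℕ) : ℝ) / d = 2 * (r / d) - 1 := by
      rw [Nat.cast_sub h]
      push_cast
      field_simp
    simp only [cappedRatio, binaryRemainder, binaryDigit, h, if_true, decide_true, hrem]
    rcases le_total ((r : ℝ) / d) 1 with h1 | h1
    · rw [min_eq_left h1, min_eq_left (by linarith)]
      ring
    · rw [min_eq_right h1, min_eq_right (by linarith)]
      norm_num
  · have hr : 2 * ((r : ℝ) / d) < 1 := by
      rw [← mul_div_assoc, div_lt_one hd']
      exact_mod_cast not_le.1 h
    have hrem : ((2 * r : ℕ) : ℝ) / d = 2 * (r / d) := by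
      push_cast
      ring
    have : 0 ≤ (r : ℝ) / d := by positivity
    simp only [cappedRatio, binaryRemainder, binaryDigit, h, if_false, decide_false, hrem]
    rw [min_eq_left (by linarith), min_eq_left hr.le]
    simp

end BinaryExpansion

/-- The data of a von Neumann schema. A trial reads input bits up to the first `false`, which gives
a number `n`, and then produces a bit that is `true` with probability `num n / den n`. According to
the verdict on `n` and this bit, the output is determined or a new trial begins. -/
structure VonNeumannSchema where
  num : ℕ → ℕ
  den : ℕ → ℕ
  verdict : ℕ → Bool → Option Bool
  den_pos : ∀ n, 0 < den n
  computable_num : Computable num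
  computable_den : Computable den
  computable_verdict : Computable₂ verdict

namespace VonNeumannSchema

/-- The states of the machine of a von Neumann schema: halted with an output, having read `n` input
bits `true` in the current trial, and comparing a random binary fraction with `r / den n`. -/
inductive State
  | halted (o : Bool)
  | counting (n : ℕ)
  | comparing (n r : ℕ)

namespace State

/-- The states as a sum type, for their numbering. -/
def equivSum : State ≃ Bool ⊕ ℕ ⊕ ℕ × ℕ where
  toFun
    | halted o => .inl o
    | counting n => .inr (.inl n)
    | comparing n r => .inr (.inr (n, r))
  invFun
    | .inl o => halted o
    | .inr (.inl n) => counting n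
    | .inr (.inr (n, r)) => comparing n r
  left_inv s := by cases s <;> rfl
  right_inv := by rintro (o | n | ⟨n, r⟩) <;> rfl

instance : Primcodable State := Primcodable.ofEquiv _ equivSum

lemma primrec_halted : Primrec halted := (Primrec.of_equiv_symm (e := equivSum)).comp .sumInl

lemma primrec_counting : Primrec counting :=
  (Primrec.of_equiv_symm (e := equivSum)).comp (Primrec.sumInr.comp .sumInl)

lemma primrec_comparing : Primrec₂ comparing :=
  (Primrec.of_equiv_symm (e := equivSum)).comp (Primrec.sumInr.comp .sumInr)

lemma computable_of_constructors {α : Type*} [Primcodable α] {f : State → α}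
    (halted : Computable fun o => f (.halted o)) (counting : Computable fun n => f (.counting n))
    (comparing : Computable₂ fun n r => f (.comparing n r)) : Computable f := by
  refine (Computable.sumCasesOn (Primrec.of_equiv (e := equivSum)).to_comp
    (halted.comp .snd).to₂ (Computable.sumCasesOn .snd (counting.comp .snd).to₂
      (comparing.comp (Computable.fst.comp .snd) (Computable.snd.comp .snd)).to₂).to₂).of_eq
    fun s => ?_
  cases s <;> rfl

end State

variable (S : VonNeumannSchema)

/-- The state after a trial with the number `n` and the bit `b`. -/
def conclude (n : ℕ) (b : Bool) : State := (S.verdict n b).elim (.counting 0) .halted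

lemma computable_conclude : Computable₂ S.conclude := by
  refine (Computable.option_casesOn S.computable_verdict (.const (State.counting 0))
    (State.primrec_halted.to_comp.comp .snd).to₂).of_eq fun z => ?_
  cases h : S.verdict z.1 z.2 <;> simp [conclude, h]

/-- The instructions of the machine. -/
def instr : State → BuffonInstr
  | .halted o => .halt o
  | .counting _ => .input
  | .comparing _ _ => .flip

/-- The transitions of the machine. Flips are made up to the first `false`, and the binary digit of
`num n / den n` at its position is the bit of the trial: it is the `i`-th digit with probability
`2⁻ⁱ`. -/
def next : State → Bool → State
  | .halted o, _ => .halted o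
  | .counting n, true => .counting (n + 1)
  | .counting n, false => .comparing n (S.num n)
  | .comparing n r, true => .comparing n (binaryRemainder (S.den n) r)
  | .comparing n r, false => S.conclude n (binaryDigit (S.den n) r)

lemma primrec_binaryDigit : Primrec₂ binaryDigit :=
  Primrec.nat_le.decide.comp .fst (Primrec.nat_mul.comp (.const 2) .snd)

lemma primrec_binaryRemainder : Primrec₂ binaryRemainder :=
  have hdouble : Primrec fun z : ℕ × ℕ => 2 * z.2 := Primrec.nat_mul.comp (.const 2) .snd
  Primrec.ite (Primrec.nat_le.comp .fst hdouble) (Primrec.nat_sub.comp hdouble .fst) hdouble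

lemma computable_next : Computable₂ S.next := by
  have hden : Computable fun z : ℕ × ℕ => S.den z.1 := S.computable_den.comp .fst
  have htrue : Computable fun s => S.next s true :=
    State.computable_of_constructors State.primrec_halted.to_comp
      (State.primrec_counting.comp .succ).to_comp
      (State.primrec_comparing.to_comp.comp .fst
        (primrec_binaryRemainder.to_comp.comp hden .snd))
  have hfalse : Computable fun s => S.next s false :=
    State.computable_of_constructors State.primrec_halted.to_comp
      (State.primrec_comparing.to_comp.comp .id S.computable_num)
      (S.computable_conclude.comp .fst (primrec_binaryDigit.to_comp.comp hden .snd))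
  refine (Computable.cond .snd (htrue.comp .fst) (hfalse.comp .fst)).of_eq ?_
  rintro ⟨s, _ | _⟩ <;> rfl

/-- The machine of a von Neumann schema. -/
def machine : BuffonMachine where
  State := State
  start := .counting 0
  instr := instr
  next := S.next
  computable_instr :=
    have : Finite BuffonInstr := .of_equiv _ BuffonInstr.equivFin.symm
    State.computable_of_constructors (Primrec.dom_finite _).to_comp (.const _) (.const _)
  computable_next := S.computable_next

section Halting

variable {S}

lemma haltsWithin_conclude {n : ℕ} {b : Bool} (h : (S.verdict n b).isSome) (k : ℕ) :
    S.machine.HaltsWithin k (S.conclude n b) := by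
  obtain ⟨o, ho⟩ := Option.isSome_iff_exists.1 h
  exact .halt (b := o) (by simp [machine, conclude, ho, instr])

lemma haltsWithin_comparing {n : ℕ} (h : (S.verdict n true).isSome) (k : ℕ) {r : ℕ} (hr : 0 < r)
    (hk : S.den n ≤ r + k) : S.machine.HaltsWithin (k + 1) (.comparing n r) := by
  induction k generalizing r with
  | zero =>
    have hdigit : binaryDigit (S.den n) r = true := decide_eq_true (by omega)
    exact .flip rfl false (by simpa only [machine, next, hdigit] using haltsWithin_conclude h 0)
  | succ k ih =>
    by_cases hle : S.den n ≤ 2 * r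
    · have hdigit : binaryDigit (S.den n) r = true := decide_eq_true hle
      exact .flip rfl false
        (by simpa only [machine, next, hdigit] using haltsWithin_conclude h (k + 1))
    · have hrem : binaryRemainder (S.den n) r = 2 * r := if_neg hle
      exact .flip rfl true
        (by simpa only [machine, next, hrem] using ih (by omega : 0 < 2 * r) (by omega))

lemma haltsWithin_counting {n L : ℕ} (h : S.machine.HaltsWithin L (.comparing n (S.num n)))
    {m : ℕ} (hmn : m ≤ n) : S.machine.HaltsWithin (L + 1 + (n - m)) (.counting m) := by
  induction hmn using Nat.decreasingInduction with
  | self => exact (BuffonMachine.HaltsWithin.input rfl false h).mono (by omega)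
  | of_succ m hm ih =>
    exact (BuffonMachine.HaltsWithin.input rfl true ih).mono (by omega)

theorem exists_forall_haltsWithin (h : ∃ n, 0 < S.num n ∧ (S.verdict n true).isSome) :
    ∃ L, ∀ s, S.machine.HaltsWithin L s := by
  obtain ⟨n, hn, hverdict⟩ := h
  obtain ⟨L, hstart⟩ : ∃ L, S.machine.HaltsWithin L (.counting 0) :=
    ⟨_, haltsWithin_counting (haltsWithin_comparing hverdict (S.den n) hn (by omega)) n.zero_le⟩
  have hconclude : ∀ m b, S.machine.HaltsWithin L (S.conclude m b) := by
    intro m b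
    cases hv : S.verdict m b with
    | none => simpa [conclude, hv] using hstart
    | some o => exact haltsWithin_conclude (by simp [hv]) L
  have hcomparing : ∀ m r, S.machine.HaltsWithin (L + 1) (.comparing m r) := fun m r =>
    .flip rfl false (hconclude m _)
  refine ⟨L + 2, fun s => ?_⟩
  cases s with
  | halted o => exact .halt (b := o) rfl
  | counting m => exact .input rfl false (hcomparing m _)
  | comparing m r => exact (hcomparing m r).mono (by omega)

end Halting

section Value

/-- The probability of the output `true` after a verdict, where it is `w` at the start of a
trial. -/
def verdictValue (w : ℝ) : Option Bool → ℝ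
  | none => w
  | some o => if o then 1 else 0

/-- The probability of the output `true` when the number of the current trial is `n` and its bit is
`true` with probability `q`, where it is `w` at the start of a trial. -/
def trialValue (w : ℝ) (n : ℕ) (q : ℝ) : ℝ :=
  q * verdictValue w (S.verdict n true) + (1 - q) * verdictValue w (S.verdict n false)

/-- The probability of the output `true` from a state, for inputs of parameter `x`, where it is `w`
at the start of a trial. -/
noncomputable def value (w x : ℝ) : State → ℝ
  | .halted o => if o then 1 else 0
  | .counting m => geometricMean x fun n =>
      S.trialValue w (n + m) (cappedRatio (S.den (n + m)) (S.num (n + m)))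
  | .comparing n r => S.trialValue w n (cappedRatio (S.den n) r)

variable {S} {w : ℝ}

lemma verdictValue_mem_Icc (hw : w ∈ Set.Icc (0 : ℝ) 1) (o : Option Bool) :
    verdictValue w o ∈ Set.Icc (0 : ℝ) 1 := by
  rcases o with _ | _ | _
  · exact hw
  · simp [verdictValue]
  · simp [verdictValue]

lemma trialValue_mem_Icc (hw : w ∈ Set.Icc (0 : ℝ) 1) (n : ℕ) {q : ℝ}
    (hq : q ∈ Set.Icc (0 : ℝ) 1) : S.trialValue w n q ∈ Set.Icc (0 : ℝ) 1 :=
  convex_Icc 0 1 (verdictValue_mem_Icc hw _) (verdictValue_mem_Icc hw _) hq.1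
    (sub_nonneg.2 hq.2) (add_sub_cancel q 1)

lemma value_mem_Icc (hw : w ∈ Set.Icc (0 : ℝ) 1) {x : ℝ} (hx : x ∈ Set.Ioo (0 : ℝ) 1)
    (s : State) : S.value w x s ∈ Set.Icc (0 : ℝ) 1 := by
  rcases s with (_ | _) | m | ⟨n, r⟩
  · simp [value]
  · simp [value]
  · exact geometricMean_mem_Icc hx fun n => trialValue_mem_Icc hw _ (cappedRatio_mem_Icc _ _)
  · exact trialValue_mem_Icc hw _ (cappedRatio_mem_Icc _ _)

lemma value_counting (hw : w ∈ Set.Icc (0 : ℝ) 1) {x : ℝ} (hx : x ∈ Set.Ioo (0 : ℝ) 1) (m : ℕ) :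
    S.value w x (.counting m) =
      x * S.value w x (.counting (m + 1)) + (1 - x) * S.value w x (.comparing m (S.num m)) := by
  have hbound : ∀ n, |S.trialValue w (n + m) (cappedRatio (S.den (n + m)) (S.num (n + m)))| ≤ 1 :=
    fun n => by
      have h := trialValue_mem_Icc (S := S) hw (n + m)
        (cappedRatio_mem_Icc (S.den (n + m)) (S.num (n + m)))
      exact abs_le.2 ⟨by linarith [h.1], h.2⟩
  have hsum := summable_mul_pow_of_abs_le hbound (x := x) (by rw [abs_of_pos hx.1]; exact hx.2)
  simpa only [value, zero_add, add_assoc, add_comm 1 m] using geometricMean_eq_add hsum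

lemma value_conclude {x : ℝ} (hw : S.value w x (.counting 0) = w) (n : ℕ) (b : Bool) :
    S.value w x (S.conclude n b) = verdictValue w (S.verdict n b) := by
  unfold conclude
  cases S.verdict n b with
  | none => exact hw
  | some o => rfl

lemma value_comparing {x : ℝ} (hw : S.value w x (.counting 0) = w) (n r : ℕ) :
    S.value w x (.comparing n r) =
      1 / 2 * S.value w x (.comparing n (binaryRemainder (S.den n) r)) +
        1 / 2 * S.value w x (S.conclude n (binaryDigit (S.den n) r)) := by
  rw [value_conclude hw]
  simp only [value, trialValue]
  rw [cappedRatio_eq_half_add_half (S.den_pos n) r]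
  cases binaryDigit (S.den n) r <;> simp only [if_true, if_false, Bool.false_eq_true] <;> ring

lemma isOutputPotential_value {p : unitInterval} (hp : (p : ℝ) ∈ Set.Ioo (0 : ℝ) 1)
    (hw : w ∈ Set.Icc (0 : ℝ) 1) (hfix : S.value w p (.counting 0) = w) :
    S.machine.IsOutputPotential p (S.value w p) where
  nonneg s := (value_mem_Icc hw hp s).1
  le_one s := (value_mem_Icc hw hp s).2
  halt := by
    rintro (o | m | ⟨n, r⟩) b hb <;> cases hb
    rfl
  harmonic := by
    funext s
    rcases s with o | m | ⟨n, r⟩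
    · rfl
    · exact (value_counting hw hp m).symm
    · refine Eq.trans ?_ (value_comparing hfix n r).symm
      change bitMean fairParameter (fun b => S.value w p (S.next (.comparing n r) b)) = _
      norm_num [bitMean, fairParameter, next]

theorem machine_stronglyRealizes {φ : ℝ → ℝ} (h : ∃ n, 0 < S.num n ∧ (S.verdict n true).isSome)
    (hφ : ∀ x ∈ Set.Ioo (0 : ℝ) 1, φ x ∈ Set.Icc (0 : ℝ) 1 ∧
      geometricMean x (fun n => S.trialValue (φ x) n (cappedRatio (S.den n) (S.num n))) = φ x) :
    S.machine.StronglyRealizes φ := by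
  obtain ⟨L, hL⟩ := exists_forall_haltsWithin h
  refine BuffonMachine.stronglyRealizes_of_outputPotential hL fun p hp0 hp1 => ?_
  have hp : (p : ℝ) ∈ Set.Ioo (0 : ℝ) 1 := ⟨hp0, hp1⟩
  obtain ⟨hw, hfix⟩ := hφ p hp
  exact ⟨S.value (φ p) p, isOutputPotential_value hp hw hfix, hfix⟩

end Value

end VonNeumannSchema

/-- A sequence of nonnegative rational numbers whose numerators and denominators are computable. A
denominator may be `0`, and then the term is `0`. -/
def IsComputablyRational (a : ℕ → ℝ) : Prop :=
  ∃ num den : ℕ → ℕ, Computable num ∧ Computable den ∧ ∀ n, a n = num n / den n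

namespace IsComputablyRational

variable {a : ℕ → ℝ}

lemma nonneg (ha : IsComputablyRational a) (n : ℕ) : 0 ≤ a n := by
  obtain ⟨num, den, -, -, h⟩ := ha
  rw [h]
  positivity

lemma inv_natCast {f : ℕ → ℕ} (hf : Computable f) :
    IsComputablyRational fun n => (f n : ℝ)⁻¹ :=
  ⟨fun _ => 1, f, .const 1, hf, fun n => by rw [Nat.cast_one, one_div]⟩

lemma ite_zero (ha : IsComputablyRational a) {p : ℕ → Prop} [DecidablePred p]
    (hp : Computable fun n => decide (p n)) :
    IsComputablyRational fun n => if p n then a n else 0 := by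
  obtain ⟨num, den, hnum, hden, h⟩ := ha
  refine ⟨fun n => bif decide (p n) then num n else 0, den, .cond hp hnum (.const 0), hden,
    fun n => ?_⟩
  by_cases hn : p n <;> simp [hn, h]

lemma exists_den_pos (ha : IsComputablyRational a) :
    ∃ num den : ℕ → ℕ, Computable num ∧ Computable den ∧ (∀ n, 0 < den n) ∧
      ∀ n, a n = num n / den n := by
  obtain ⟨num, den, hnum, hden, h⟩ := ha
  have hzero : Computable fun n => decide (den n = 0) :=
    (Primrec.eq.comp .id (.const 0)).decide.to_comp.comp hden
  refine ⟨fun n => bif decide (den n = 0) then 0 else num n,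
    fun n => bif decide (den n = 0) then 1 else den n,
    .cond hzero (.const 0) hnum, .cond hzero (.const 1) hden, fun n => ?_, fun n => ?_⟩
  · by_cases hn : den n = 0
    · simp [hn]
    · simpa [hn] using Nat.pos_of_ne_zero hn
  · by_cases hn : den n = 0 <;> simp [hn, h]

open VonNeumannSchema in
theorem exists_stronglyRealizes (ha : IsComputablyRational a) (hle : ∀ n, a n ≤ 1)
    {verdict : ℕ → Bool → Option Bool} (hverdict : Computable₂ verdict)
    (hpos : ∃ n, 0 < a n ∧ (verdict n true).isSome) {φ : ℝ → ℝ}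
    (hφ : ∀ x ∈ Set.Ioo (0 : ℝ) 1, φ x ∈ Set.Icc (0 : ℝ) 1 ∧
      geometricMean x (fun n => a n * verdictValue (φ x) (verdict n true) +
        (1 - a n) * verdictValue (φ x) (verdict n false)) = φ x) :
    ∃ M : BuffonMachine, M.StronglyRealizes φ := by
  obtain ⟨num, den, hnum, hden, hden_pos, h⟩ := ha.exists_den_pos
  obtain ⟨n, hn, hn'⟩ := hpos
  have hnum_pos : 0 < num n := by
    rw [h] at hn
    by_contra h0
    simp [Nat.eq_zero_of_not_pos h0] at hn
  have hratio : ∀ n, cappedRatio (den n) (num n) = a n := fun n => by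
    rw [cappedRatio, ← h, min_eq_left (hle n)]
  let S : VonNeumannSchema := ⟨num, den, verdict, hden_pos, hnum, hden, hverdict⟩
  exact ⟨S.machine, S.machine_stronglyRealizes ⟨n, hnum_pos, hn'⟩
    (by simpa only [S, trialValue, hratio] using hφ)⟩

end IsComputablyRational

section PowerSeries

variable {a : ℕ → ℝ} {A : ℝ → ℝ}

theorem stronglyRealizable_one_sub_mul (ha : IsComputablyRational a) (hle : ∀ n, a n ≤ 1)
    (hpos : ∃ n, 0 < a n) (hlt : ∃ n, a n < 1)
    (hA : ∀ x ∈ Set.Ioo (0 : ℝ) 1, HasSum (fun n => a n * x ^ n) (A x)) :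
    StronglyRealizable fun x => (1 - x) * A x := by
  have hmem : ∀ x ∈ Set.Ioo (0 : ℝ) 1, (1 - x) * A x ∈ Set.Ioo (0 : ℝ) 1 := by
    intro x hx
    have hx' : 0 < 1 - x := sub_pos.2 hx.2
    have hpow := fun n => pow_pos hx.1 n
    obtain ⟨m, hm⟩ := hpos
    obtain ⟨l, hl⟩ := hlt
    have hA0 : 0 < A x := hasSum_lt (fun n => mul_nonneg (ha.nonneg n) (hpow n).le)
      (mul_pos hm (hpow m)) hasSum_zero (hA x hx)
    have hA1 : A x < (1 - x)⁻¹ := hasSum_lt (fun n => mul_le_of_le_one_left (hpow n).le (hle n))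
      (mul_lt_of_lt_one_left (hpow l) hl) (hA x hx) (hasSum_geometric_of_lt_one hx.1.le hx.2)
    exact ⟨mul_pos hx' hA0, (lt_inv_mul_iff₀ hx').1 (by rwa [mul_one])⟩
  refine ⟨hmem, ha.exists_stronglyRealizes hle (verdict := fun _ b => some b)
    (Computable.option_some.comp .snd) (by simpa using hpos) fun x hx =>
      ⟨Set.Ioo_subset_Icc_self (hmem x hx), ?_⟩⟩
  simpa [VonNeumannSchema.verdictValue] using geometricMean_eq_of_hasSum (hA x hx)

theorem stronglyRealizable_mul_pow_div (ha : IsComputablyRational a) (hle : ∀ n, a n ≤ 1) {k : ℕ}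
    (hk : 0 < a k) (hne : ∃ n ≠ k, 0 < a n)
    (hA : ∀ x ∈ Set.Ioo (0 : ℝ) 1, HasSum (fun n => a n * x ^ n) (A x)) :
    StronglyRealizable fun x => a k * x ^ k / A x := by
  have hterm : ∀ x ∈ Set.Ioo (0 : ℝ) 1, 0 < a k * x ^ k := fun x hx =>
    mul_pos hk (pow_pos hx.1 k)
  have hlt : ∀ x ∈ Set.Ioo (0 : ℝ) 1, a k * x ^ k < A x := by
    intro x hx
    obtain ⟨m, hmk, hm⟩ := hne
    exact lt_hasSum (hA x hx) k (fun n _ => mul_nonneg (ha.nonneg n) (pow_nonneg hx.1.le n)) m hmk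
      (mul_pos hm (pow_pos hx.1 m))
  have hmem : ∀ x ∈ Set.Ioo (0 : ℝ) 1, a k * x ^ k / A x ∈ Set.Ioo (0 : ℝ) 1 := fun x hx =>
    have hA0 := (hterm x hx).trans (hlt x hx)
    ⟨div_pos (hterm x hx) hA0, (div_lt_one hA0).2 (hlt x hx)⟩
  have hverdict : Computable₂ fun n b => bif b then some (decide (n = k)) else none :=
    .cond .snd (Computable.option_some.comp
      ((Primrec.eq.comp .id (.const k)).decide.to_comp.comp .fst)) (.const none)
  refine ⟨hmem, ha.exists_stronglyRealizes hle hverdict ⟨k, hk, rfl⟩ fun x hx =>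
    ⟨Set.Ioo_subset_Icc_self (hmem x hx), ?_⟩⟩
  have hA0 : A x ≠ 0 := ((hterm x hx).trans (hlt x hx)).ne'
  have hx' : 1 - x ≠ 0 := (sub_pos.2 hx.2).ne'
  set w := a k * x ^ k / A x with hw
  have hsum : HasSum (fun n => (a n * (if n = k then 1 else 0) + (1 - a n) * w) * x ^ n)
      (a k * x ^ k + w * (1 - x)⁻¹ - w * A x) := by
    refine (((hasSum_ite_eq k (a k * x ^ k)).add ((hasSum_geometric_of_lt_one hx.1.le
      hx.2).mul_left w)).sub ((hA x hx).mul_left w)).congr_fun fun n => ?_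
    split_ifs with hn
    · rw [hn]
      ring
    · ring
  have hmean := geometricMean_eq_of_hasSum hsum
  simp only [cond_true, cond_false, VonNeumannSchema.verdictValue, decide_eq_true_eq]
  rw [hmean, hw]
  field_simp
  ring

end PowerSeries

section PrimitiveRecursion

lemma primrec₂_descFactorial : Primrec₂ Nat.descFactorial :=
  (Primrec.nat_rec (.const 1) (Primrec.nat_mul.comp
    (Primrec.nat_sub.comp .fst (Primrec.fst.comp .snd)) (Primrec.snd.comp .snd)).to₂).of_eq
    fun n k => by
      induction k with
      | zero => rfl
      | succ k ih => rw [Nat.descFactorial_succ, ← ih]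

lemma primrec_factorial : Primrec Nat.factorial :=
  (primrec₂_descFactorial.comp .id .id).of_eq Nat.descFactorial_self

lemma primrec₂_choose : Primrec₂ Nat.choose :=
  (Primrec.nat_div.comp₂ primrec₂_descFactorial (primrec_factorial.comp₂ .right)).of_eq
    fun n k => (Nat.choose_eq_descFactorial_div_factorial n k).symm

lemma primrec_sum_range {α : Type*} [Primcodable α] {f : α → ℕ → ℕ} {g : α → ℕ} (hf : Primrec₂ f)
    (hg : Primrec g) : Primrec fun a => ∑ i ∈ Finset.range (g a), f a i :=
  (Primrec.nat_rec' hg (.const 0) (Primrec.nat_add.comp (Primrec.snd.comp .snd)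
    (hf.comp .fst (Primrec.fst.comp .snd))).to₂).of_eq fun a => by
      induction g a with
      | zero => rfl
      | succ n ih => rw [Finset.sum_range_succ, ← ih]

end PrimitiveRecursion

section Zigzag

/-- The numbers `2 ^ n * E n`, where the zigzag number `E n` counts the alternating permutations of
`n` elements. The recursion is that of the Taylor coefficients of `f y = tan (y + π / 4)`, times
`n!`, from `f' = 1 + f ^ 2`. -/
def scaledZigzag (n : ℕ) : ℕ :=
  (if n ≤ 1 then 1 else 0) +
    ∑ i : Fin n, (n - 1).choose i * scaledZigzag i * scaledZigzag (n - 1 - i)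

lemma scaledZigzag_eq (n : ℕ) :
    scaledZigzag n = (if n ≤ 1 then 1 else 0) +
      ∑ i ∈ Finset.range n, (n - 1).choose i * scaledZigzag i * scaledZigzag (n - 1 - i) := by
  rw [scaledZigzag, Finset.sum_range fun i =>
    (n - 1).choose i * scaledZigzag i * scaledZigzag (n - 1 - i)]

lemma scaledZigzag_pos (n : ℕ) : 0 < scaledZigzag n := by
  induction n using Nat.strong_induction_on with
  | _ n ih =>
    rw [scaledZigzag_eq]
    split_ifs with hn
    · omega
    · refine Nat.add_pos_right _ (Finset.sum_pos (fun i hi => ?_) ⟨0, by simp; omega⟩)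
      have hi := Finset.mem_range.1 hi
      have hchoose := Nat.choose_pos (show i ≤ n - 1 by omega)
      have hi' := ih i hi
      have hi'' := ih (n - 1 - i) (by omega)
      positivity

lemma primrec_scaledZigzag : Primrec scaledZigzag := by
  let step (l : List ℕ) : ℕ := (if l.length ≤ 1 then 1 else 0) + ∑ i ∈ Finset.range l.length,
    (l.length - 1).choose i * l.getD i 0 * l.getD (l.length - 1 - i) 0
  have hpred : Primrec fun l : List ℕ => l.length - 1 := Primrec.pred.comp .list_length
  have hpred' : Primrec fun z : List ℕ × ℕ => z.1.length - 1 := hpred.comp .fst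
  have hstep : Primrec step := Primrec.nat_add.comp
    (Primrec.ite (Primrec.nat_le.comp .list_length (.const 1)) (.const 1) (.const 0))
    (primrec_sum_range (Primrec.nat_mul.comp (Primrec.nat_mul.comp
      (primrec₂_choose.comp hpred' .snd) ((Primrec.list_getD 0).comp .fst .snd))
      ((Primrec.list_getD 0).comp .fst (Primrec.nat_sub.comp hpred' .snd))).to₂ .list_length)
  have hrec : ∀ n, step ((List.range n).map scaledZigzag) = scaledZigzag n := by
    intro n
    have hget : ∀ i < n, ((List.range n).map scaledZigzag).getD i 0 = scaledZigzag i :=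
      fun i hi => by simp [hi]
    simp only [step, List.length_map, List.length_range]
    rw [scaledZigzag_eq]
    congr 1
    refine Finset.sum_congr rfl fun i hi => ?_
    have hi := Finset.mem_range.1 hi
    rw [hget i hi, hget (n - 1 - i) (by omega)]
  exact (Primrec.nat_strong_rec (fun _ : Unit => scaledZigzag) (g := fun _ l => some (step l))
    (Primrec.option_some.comp (hstep.comp .snd)).to₂
    fun _ n => congrArg some (hrec n)).comp (.const ()) .id

/-- The Taylor coefficients `E n / n!` of `tan (x / 2 + π / 4) = 1 / cos x + tan x`. -/
noncomputable def zigzagCoeff (n : ℕ) : ℝ := scaledZigzag n / (2 ^ n * n.factorial)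

lemma isComputablyRational_zigzagCoeff : IsComputablyRational zigzagCoeff :=
  have hpow : Primrec fun n : ℕ => 2 ^ n :=
    (Primrec₂.unpaired'.1 Nat.Primrec.pow).comp (.const 2) .id
  ⟨scaledZigzag, fun n => 2 ^ n * n.factorial, primrec_scaledZigzag.to_comp,
    (Primrec.nat_mul.comp hpow primrec_factorial).to_comp,
    fun n => by rw [zigzagCoeff]; push_cast; rfl⟩

lemma zigzagCoeff_pos (n : ℕ) : 0 < zigzagCoeff n := by
  have := scaledZigzag_pos n
  unfold zigzagCoeff
  positivity

lemma zigzagCoeff_zero : zigzagCoeff 0 = 1 := by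
  have h : scaledZigzag 0 = 1 := scaledZigzag_eq 0
  simp [zigzagCoeff, h]

lemma choose_mul_scaledZigzag_mul {i n : ℕ} (hi : i ≤ n) :
    ((n.choose i * scaledZigzag i * scaledZigzag (n - i) : ℕ) : ℝ) =
      2 ^ n * n.factorial * (zigzagCoeff i * zigzagCoeff (n - i)) := by
  have hpow : (2 : ℝ) ^ n = 2 ^ i * 2 ^ (n - i) := by rw [← pow_add, Nat.add_sub_cancel' hi]
  unfold zigzagCoeff
  push_cast
  rw [Nat.cast_choose ℝ hi, hpow]
  field_simp

lemma zigzagCoeff_succ (n : ℕ) :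
    2 * ((n + 1) * zigzagCoeff (n + 1)) = (if n = 0 then 1 else 0) +
      ∑ i ∈ Finset.range (n + 1), zigzagCoeff i * zigzagCoeff (n - i) := by
  have hz : (scaledZigzag (n + 1) : ℝ) = 2 ^ n * n.factorial * ((if n = 0 then 1 else 0) +
      ∑ i ∈ Finset.range (n + 1), zigzagCoeff i * zigzagCoeff (n - i)) := by
    rw [scaledZigzag_eq, Nat.add_sub_cancel, Nat.cast_add, Nat.cast_sum, mul_add, Finset.mul_sum,
      Finset.sum_congr rfl fun i hi => choose_mul_scaledZigzag_mul
        (Nat.lt_succ_iff.1 (Finset.mem_range.1 hi))]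
    congr 1
    rcases n with _ | n <;> simp
  rw [zigzagCoeff, hz, pow_succ, Nat.factorial_succ]
  push_cast
  field_simp

lemma zigzagCoeff_one : zigzagCoeff 1 = 1 := by
  have h := zigzagCoeff_succ 0
  norm_num [zigzagCoeff_zero] at h
  exact h

lemma zigzagCoeff_le_one (n : ℕ) : zigzagCoeff n ≤ 1 := by
  induction n using Nat.strong_induction_on with
  | _ n ih =>
    rcases n with _ | n
    · exact zigzagCoeff_zero.le
    · have hsum : ∑ i ∈ Finset.range (n + 1), zigzagCoeff i * zigzagCoeff (n - i) ≤ n + 1 := by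
        refine (Finset.sum_le_card_nsmul _ _ 1 fun i hi => mul_le_one₀ (ih i ?_)
          (zigzagCoeff_pos _).le (ih (n - i) (by omega))).trans_eq (by simp)
        exact Finset.mem_range.1 hi
      have hone : (if n = 0 then (1 : ℝ) else 0) ≤ 1 := by split_ifs <;> norm_num
      nlinarith [zigzagCoeff_succ n, (n.cast_nonneg : (0 : ℝ) ≤ n)]

end Zigzag

section BoundedCoefficients

variable {a : ℕ → ℝ} {C x : ℝ}

lemma hasSum_sum_range_mul_pow (ha : ∀ n, |a n| ≤ C) {b : ℕ → ℝ} {D : ℝ} (hb : ∀ n, |b n| ≤ D)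
    (hx : |x| < 1) :
    HasSum (fun n => (∑ i ∈ Finset.range (n + 1), a i * b (n - i)) * x ^ n)
      ((∑' n, a n * x ^ n) * ∑' n, b n * x ^ n) := by
  refine (hasSum_sum_range_mul_of_summable_norm (summable_mul_pow_of_abs_le ha hx).norm
    (summable_mul_pow_of_abs_le hb hx).norm).congr_fun fun n => ?_
  rw [Finset.sum_mul]
  refine Finset.sum_congr rfl fun i hi => ?_
  have hpow : x ^ n = x ^ i * x ^ (n - i) := by
    rw [← pow_add, Nat.add_sub_cancel' (Nat.lt_succ_iff.1 (Finset.mem_range.1 hi))]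
  rw [hpow]
  ring

lemma hasDerivAt_tsum_mul_pow (ha : ∀ n, |a n| ≤ C) (hx : |x| < 1) :
    HasDerivAt (fun y => ∑' n, a n * y ^ n) (∑' n, a n * (n * x ^ (n - 1))) x := by
  obtain ⟨r, hxr, hr⟩ := exists_between hx
  have hr0 : 0 ≤ r := (abs_nonneg x).trans hxr.le
  have hbound : Summable fun n : ℕ => C * (n * r ^ (n - 1)) := by
    refine .mul_left C ((summable_nat_add_iff 1).1 ?_)
    refine ((summable_pow_mul_geometric_of_norm_lt_one 1 (by rwa [Real.norm_of_nonneg hr0])).add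
      (summable_geometric_of_lt_one hr0 hr)).congr fun n => ?_
    rw [Nat.add_sub_cancel]
    push_cast
    ring
  have hmem : x ∈ Metric.ball (0 : ℝ) r := mem_ball_zero_iff.2 hxr
  refine hasDerivAt_tsum_of_isPreconnected (g := fun n y => a n * y ^ n)
    (g' := fun n y => a n * (n * y ^ (n - 1))) hbound Metric.isOpen_ball
    (convex_ball 0 r).isPreconnected (fun n y _ => (hasDerivAt_pow n y).const_mul _)
    (fun n y hy => ?_) hmem (summable_mul_pow_of_abs_le ha hx) hmem
  have hC : 0 ≤ C := (abs_nonneg _).trans (ha 0)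
  have hy : |y| ≤ r := (mem_ball_zero_iff.1 hy).le
  rw [Real.norm_eq_abs, abs_mul, abs_mul, abs_pow, Nat.abs_cast]
  gcongr
  exact ha n

end BoundedCoefficients

section EvenOddParts

variable {a : ℕ → ℝ} {x s t : ℝ}

lemma hasSum_even_part (hs : HasSum (fun n => a n * x ^ n) s)
    (ht : HasSum (fun n => a n * (-x) ^ n) t) :
    HasSum (fun n => (if Even n then a n else 0) * x ^ n) ((s + t) / 2) := by
  refine ((hs.add ht).div_const 2).congr_fun fun n => ?_
  rcases n.even_or_odd with h | h
  · rw [if_pos h, h.neg_pow]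
    ring
  · rw [if_neg (Nat.not_even_iff_odd.2 h), h.neg_pow]
    ring

lemma hasSum_odd_part (hs : HasSum (fun n => a n * x ^ n) s)
    (ht : HasSum (fun n => a n * (-x) ^ n) t) :
    HasSum (fun n => (if Odd n then a n else 0) * x ^ n) ((s - t) / 2) := by
  refine ((hs.sub ht).div_const 2).congr_fun fun n => ?_
  rcases n.even_or_odd with h | h
  · rw [if_neg (Nat.not_odd_iff_even.2 h), h.neg_pow]
    ring
  · rw [if_pos h, h.neg_pow]
    ring

end EvenOddParts

section Trigonometric

variable {x : ℝ}

/-- The exponential generating function of the zigzag numbers. -/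
noncomputable def zigzagSeries (x : ℝ) : ℝ := ∑' n, zigzagCoeff n * x ^ n

lemma abs_zigzagCoeff_le_one (n : ℕ) : |zigzagCoeff n| ≤ 1 := by
  rw [abs_of_pos (zigzagCoeff_pos n)]
  exact zigzagCoeff_le_one n

lemma zigzagSeries_zero : zigzagSeries 0 = 1 := by
  rw [zigzagSeries, tsum_eq_single 0 fun n hn => by simp [hn], zigzagCoeff_zero, pow_zero, one_mul]

lemma hasDerivAt_zigzagSeries (hx : |x| < 1) :
    HasDerivAt zigzagSeries ((1 + zigzagSeries x ^ 2) / 2) x := by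
  refine (hasDerivAt_tsum_mul_pow abs_zigzagCoeff_le_one hx).congr_deriv (HasSum.tsum_eq ?_)
  rw [← hasSum_nat_add_iff' 1]
  simp only [Finset.sum_range_one, Nat.cast_zero, zero_mul, mul_zero, sub_zero]
  have hsq := hasSum_sum_range_mul_pow abs_zigzagCoeff_le_one abs_zigzagCoeff_le_one hx
  rw [← zigzagSeries, ← sq] at hsq
  refine (((hasSum_ite_eq 0 (1 : ℝ)).add hsq).div_const 2).congr_fun fun n => ?_
  have hone : (if n = 0 then (1 : ℝ) else 0) = (if n = 0 then 1 else 0) * x ^ n := by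
    split_ifs with h <;> simp [h]
  rw [hone, ← add_mul, ← zigzagCoeff_succ, Nat.add_sub_cancel]
  push_cast
  ring

lemma zigzagSeries_eq_tan (hx : |x| < 1) :
    zigzagSeries x = Real.tan (x / 2 + Real.pi / 4) := by
  have hder : ∀ y ∈ Metric.ball (0 : ℝ) 1,
      HasDerivAt (fun y => Real.arctan (zigzagSeries y) - y / 2) 0 y := by
    intro y hy
    have hne : 1 + zigzagSeries y ^ 2 ≠ 0 := by positivity
    refine ((hasDerivAt_zigzagSeries (mem_ball_zero_iff.1 hy)).arctan.sub
      ((hasDerivAt_id y).div_const 2)).congr_deriv ?_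
    field_simp
    ring
  have hconst := Metric.isOpen_ball.is_const_of_deriv_eq_zero (convex_ball (0 : ℝ) 1).isPreconnected
    (fun y hy => (hder y hy).differentiableAt.differentiableWithinAt)
    (fun y hy => (hder y hy).deriv) (mem_ball_zero_iff.2 hx) (Metric.mem_ball_self one_pos)
  simp only [zigzagSeries_zero, Real.arctan_one, zero_div, sub_zero] at hconst
  rw [← Real.tan_arctan (zigzagSeries x), sub_eq_iff_eq_add'.1 hconst]

lemma tan_half_add_pi_div_four (x : ℝ) :
    Real.tan (x / 2 + Real.pi / 4) = (Real.cos x)⁻¹ + Real.tan x := by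
  obtain ⟨u, rfl⟩ : ∃ u, x = 2 * u - Real.pi / 2 := ⟨x / 2 + Real.pi / 4, by ring⟩
  have hu : (2 * u - Real.pi / 2) / 2 + Real.pi / 4 = u := by ring
  rw [hu, Real.tan_eq_sin_div_cos (2 * u - _), Real.cos_sub_pi_div_two, Real.sin_sub_pi_div_two,
    Real.cos_two_mul', Real.sin_two_mul, Real.tan_eq_sin_div_cos]
  by_cases hs : Real.sin u = 0
  · simp [hs]
  by_cases hc : Real.cos u = 0
  · simp [hc]
  have hsq := Real.sin_sq_add_cos_sq u
  field_simp
  linarith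

lemma hasSum_zigzagCoeff_mul_pow (hx : |x| < 1) :
    HasSum (fun n => zigzagCoeff n * x ^ n) ((Real.cos x)⁻¹ + Real.tan x) := by
  rw [← tan_half_add_pi_div_four, ← zigzagSeries_eq_tan hx]
  exact (summable_mul_pow_of_abs_le abs_zigzagCoeff_le_one hx).hasSum

lemma hasSum_zigzagCoeff_mul_neg_pow (hx : |x| < 1) :
    HasSum (fun n => zigzagCoeff n * (-x) ^ n) ((Real.cos x)⁻¹ - Real.tan x) := by
  simpa [sub_eq_add_neg] using hasSum_zigzagCoeff_mul_pow (x := -x) (by rwa [abs_neg])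

lemma hasSum_inv_cos (hx : |x| < 1) :
    HasSum (fun n => (if Even n then zigzagCoeff n else 0) * x ^ n) (Real.cos x)⁻¹ := by
  convert hasSum_even_part (hasSum_zigzagCoeff_mul_pow hx) (hasSum_zigzagCoeff_mul_neg_pow hx)
    using 1
  ring

lemma hasSum_tan (hx : |x| < 1) :
    HasSum (fun n => (if Odd n then zigzagCoeff n else 0) * x ^ n) (Real.tan x) := by
  convert hasSum_odd_part (hasSum_zigzagCoeff_mul_pow hx) (hasSum_zigzagCoeff_mul_neg_pow hx)
    using 1
  ring

end Trigonometric

section ExpLog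

lemma hasSum_exp (x : ℝ) : HasSum (fun n : ℕ => (n.factorial : ℝ)⁻¹ * x ^ n) (Real.exp x) := by
  rw [Real.exp_eq_exp_ℝ]
  exact NormedSpace.exp_series_hasSum_exp' (𝕂 := ℝ) x

lemma hasSum_log_one_div_one_sub {x : ℝ} (hx : |x| < 1) :
    HasSum (fun n : ℕ => (n : ℝ)⁻¹ * x ^ n) (Real.log (1 / (1 - x))) := by
  rw [one_div, Real.log_inv, ← hasSum_nat_add_iff' 1]
  simpa [div_eq_inv_mul] using Real.hasSum_pow_div_log_of_abs_lt_one hx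

end ExpLog

lemma abs_lt_one_of_mem_Ioo {x : ℝ} (hx : x ∈ Set.Ioo (0 : ℝ) 1) : |x| < 1 := by
  rw [abs_of_pos hx.1]
  exact hx.2

theorem stronglyRealizable_one_sub_mul_exp :
    StronglyRealizable fun x => (1 - x) * Real.exp x :=
  stronglyRealizable_one_sub_mul (.inv_natCast primrec_factorial.to_comp)
    (fun n => Nat.cast_inv_le_one _) ⟨0, by norm_num⟩ ⟨2, by norm_num⟩ fun x _ => hasSum_exp x

theorem stronglyRealizable_exp_neg : StronglyRealizable fun x => Real.exp (-x) := by
  simpa [Real.exp_neg] using stronglyRealizable_mul_pow_div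
    (.inv_natCast primrec_factorial.to_comp) (fun n => Nat.cast_inv_le_one _) (k := 0)
    (by norm_num) ⟨1, one_ne_zero, by norm_num⟩ fun x _ => hasSum_exp x

theorem stronglyRealizable_one_sub_mul_log :
    StronglyRealizable fun x => (1 - x) * Real.log (1 / (1 - x)) :=
  stronglyRealizable_one_sub_mul (.inv_natCast .id) (fun n => Nat.cast_inv_le_one _)
    ⟨1, by norm_num⟩ ⟨0, by norm_num⟩ fun x hx =>
      hasSum_log_one_div_one_sub (abs_lt_one_of_mem_Ioo hx)

theorem stronglyRealizable_div_log :
    StronglyRealizable fun x => x / Real.log (1 / (1 - x)) := by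
  simpa using stronglyRealizable_mul_pow_div (.inv_natCast .id)
    (fun n => Nat.cast_inv_le_one _) (k := 1) (by norm_num) ⟨2, by norm_num, by norm_num⟩
    fun x hx => hasSum_log_one_div_one_sub (abs_lt_one_of_mem_Ioo hx)

lemma computable_decide_mod_two_eq (r : ℕ) : Computable fun n : ℕ => decide (n % 2 = r) :=
  (Primrec.eq.comp (Primrec.nat_mod.comp .id (.const 2)) (.const r)).decide.to_comp

lemma isComputablyRational_ite_even_zigzagCoeff :
    IsComputablyRational fun n => if Even n then zigzagCoeff n else 0 :=
  isComputablyRational_zigzagCoeff.ite_zero <|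
    (computable_decide_mod_two_eq 0).of_eq fun _ => decide_eq_decide.2 Nat.even_iff.symm

lemma isComputablyRational_ite_odd_zigzagCoeff :
    IsComputablyRational fun n => if Odd n then zigzagCoeff n else 0 :=
  isComputablyRational_zigzagCoeff.ite_zero <|
    (computable_decide_mod_two_eq 1).of_eq fun _ => decide_eq_decide.2 Nat.odd_iff.symm

lemma ite_zigzagCoeff_le_one (p : Prop) [Decidable p] (n : ℕ) :
    (if p then zigzagCoeff n else 0) ≤ 1 := by
  split_ifs
  exacts [zigzagCoeff_le_one n, zero_le_one]

theorem stronglyRealizable_one_sub_div_cos :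
    StronglyRealizable fun x => (1 - x) / Real.cos x :=
  stronglyRealizable_one_sub_mul isComputablyRational_ite_even_zigzagCoeff
    (fun _ => ite_zigzagCoeff_le_one _ _) ⟨0, by simp [zigzagCoeff_pos]⟩ ⟨1, by simp⟩
    fun x hx => hasSum_inv_cos (abs_lt_one_of_mem_Ioo hx)

theorem stronglyRealizable_cos : StronglyRealizable fun x => Real.cos x := by
  simpa [zigzagCoeff_zero] using stronglyRealizable_mul_pow_div
    isComputablyRational_ite_even_zigzagCoeff (fun _ => ite_zigzagCoeff_le_one _ _) (k := 0)
    (by simp [zigzagCoeff_pos]) ⟨2, two_ne_zero, by simp [zigzagCoeff_pos]⟩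
    fun x hx => hasSum_inv_cos (abs_lt_one_of_mem_Ioo hx)

theorem stronglyRealizable_one_sub_mul_tan :
    StronglyRealizable fun x => (1 - x) * Real.tan x :=
  stronglyRealizable_one_sub_mul isComputablyRational_ite_odd_zigzagCoeff
    (fun _ => ite_zigzagCoeff_le_one _ _) ⟨1, by simp [zigzagCoeff_pos]⟩ ⟨0, by simp⟩
    fun x hx => hasSum_tan (abs_lt_one_of_mem_Ioo hx)

theorem stronglyRealizable_div_tan : StronglyRealizable fun x => x / Real.tan x := by
  simpa [zigzagCoeff_one] using stronglyRealizable_mul_pow_div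
    isComputablyRational_ite_odd_zigzagCoeff (fun _ => ite_zigzagCoeff_le_one _ _) (k := 1)
    (by simp [zigzagCoeff_pos]) ⟨3, by norm_num, by simp [zigzagCoeff_pos, Nat.odd_iff]⟩
    fun x hx => hasSum_tan (abs_lt_one_of_mem_Ioo hx)

theorem theorem4 :
    StronglyRealizable (fun x => Real.exp (-x)) ∧
    StronglyRealizable (fun x => Real.exp (x - 1)) ∧
    StronglyRealizable (fun x => (1 - x) * Real.exp x) ∧
    StronglyRealizable (fun x => x * Real.exp (1 - x)) ∧
    StronglyRealizable (fun x => x / Real.log (1 / (1 - x))) ∧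
    StronglyRealizable (fun x => (1 - x) / Real.log (1 / x)) ∧
    StronglyRealizable (fun x => (1 - x) * Real.log (1 / (1 - x))) ∧
    StronglyRealizable (fun x => x * Real.log (1 / x)) ∧
    StronglyRealizable (fun x => Real.cos x) ∧
    StronglyRealizable (fun x => (1 - x) / Real.cos x) ∧
    StronglyRealizable (fun x => x / Real.tan x) ∧
    StronglyRealizable (fun x => (1 - x) * Real.tan x) :=
  ⟨stronglyRealizable_exp_neg,
    by simpa using stronglyRealizable_exp_neg.comp_one_sub,
    stronglyRealizable_one_sub_mul_exp,
    by simpa using stronglyRealizable_one_sub_mul_exp.comp_one_sub,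
    stronglyRealizable_div_log,
    by simpa using stronglyRealizable_div_log.comp_one_sub,
    stronglyRealizable_one_sub_mul_log,
    by simpa using stronglyRealizable_one_sub_mul_log.comp_one_sub,
    stronglyRealizable_cos,
    stronglyRealizable_one_sub_div_cos,
    stronglyRealizable_div_tan,
    stronglyRealizable_one_sub_mul_tan⟩
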